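/- Let $n\ge 2$. Let $B_n$ be the braid group on $n$ strands with Artin generators $\sigma_1,\dots,\sigma_{n-1}$ (relations $\sigma_i\sigma_j=\sigma_j\sigma_i$ for $|i-j|>1$ and $\sigma_i\sigma_j\sigma_i=\sigma_j\sigma_i\sigma_j$ for $|i-j|=1$), let $M=B_n^+\subseteq B_n$ be the submonoid generated by $\mathcal A=\{\sigma_1,\dots,\sigma_{n-1}\}$, and for $a,b\in M$ write $a\preccurlyeq b$ if $b=ac$ for some $c\in M$. This is a lattice order on $M$; write $a\vee b$ for the least common multiple of $a,b$ and $a\backslash b$ for the element of $M$ with $a\vee b=a(a\backslash b)$. For $X\subseteq M$ let $\min_\preccurlyeq X$ be the set of $\preccurlyeq$-minimal elements of $X$. All words in $\mathcal A^*$ representing a given $\beta\in M$ have the same length; let $\omega(\beta)\in\mathcal A^*$ be the lexicographically smallest of them (with $\sigma_1<\dots<\sigma_{n-1}$), and let $L_n=\{\omega(\beta)\mid\beta\in M\}$. For $w\in L_n$ put $F_n(w)=\{\alpha\in M\mid w\,\omega(\alpha)\notin L_n\}$ and $F_n^{\min}(w)=\min_\preccurlyeq F_n(w)$. Let $\Gamma_n=(\mathcal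 S,\mathcal A,\mu,Y,S_0)$, where $\mathcal S=\{F_n^{\min}(w)\mid w\in L_n\}\cup\{\mathcal A\}$ (sets of positive braids), $S_0=\emptyset=F_n^{\min}(\epsilon)$, $Y=\mathcal S\setminus\{\mathcal A\}$, and $$\mu(S,\sigma_i)=\begin{cases}\mathcal A&\text{if }\sigma_i\in S,\\ \min_\preccurlyeq\big(\{\sigma_1,\dots,\sigma_{i-2},\sigma_{i-1}\sigma_i\}\cup\{\sigma_i\backslash\beta\mid\beta\in S\}\big)&\text{otherwise,}\end{cases}$$ where words involving indices less than $1$ are ignored. (1) $\Gamma_n$ is a (deterministic, complete) finite state automaton, that is, $\mathcal S$ is finite and $\mu$ maps $\mathcal S\times\mathcal A$ to $\mathcal S$, and the language accepted by $\Gamma_n$ is $L_n$. (2) If $n\ge 3$, then every (deterministic, complete) finite state automaton over $\mathcal A$ accepting the language $L_n$ has at least as many states as $\Gamma_n$. -/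

import Mathlib

namespace PosBraid

/-- The Artin relations of the braid group on `n` strands. The index `i : Fin (n - 1)` stands for
the generator usually called `σ_(i+1)`. -/
def artinRels (n : ℕ) : Set (FreeGroup (Fin (n - 1))) :=
  {r | ∃ i j : Fin (n - 1), (i : ℕ) + 1 < j ∧
      r = FreeGroup.of i * FreeGroup.of j * (FreeGroup.of j * FreeGroup.of i)⁻¹} ∪
  {r | ∃ i j : Fin (n - 1), (i : ℕ) + 1 = j ∧
      r = FreeGroup.of i * FreeGroup.of j * FreeGroup.of i *
        (FreeGroup.of j * FreeGroup.of i * FreeGroup.of j)⁻¹}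

/-- The braid group on `n` strands. -/
abbrev BraidGroup (n : ℕ) : Type := PresentedGroup (artinRels n)

/-- The monoid of positive braids: the submonoid of the braid group generated by the Artin
generators. -/
abbrev BraidMonoid (n : ℕ) : Type :=
  ↥(Submonoid.closure (Set.range fun i : Fin (n - 1) =>
    (PresentedGroup.of i : BraidGroup n)))

/-- The Artin generators (atoms) as positive braids. -/
def σ {n : ℕ} (i : Fin (n - 1)) : BraidMonoid n :=
  ⟨PresentedGroup.of i, Submonoid.subset_closure ⟨i, rfl⟩⟩

/-- The positive braid represented by a word in the Artin generators. -/
def braidOf {n : ℕ} (w : List (Fin (n - 1))) : BraidMonoid n := (w.map σ).prod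

/-- The homomorphism to `ℤ` (exponent sum). -/
def lengthHom (n : ℕ) : BraidGroup n →* Multiplicative ℤ :=
  PresentedGroup.toGroup (f := fun _ => Multiplicative.ofAdd (1 : ℤ)) (by
    rintro r (⟨i, j, -, rfl⟩ | ⟨i, j, -, rfl⟩) <;> simp)

theorem lengthHom_braidOf {n : ℕ} (w : List (Fin (n - 1))) :
    lengthHom n (braidOf w : BraidMonoid n) = Multiplicative.ofAdd (w.length : ℤ) := by
  induction w with
  | nil => simp [braidOf]
  | cons a w ih =>
    have h : (braidOf (a :: w) : BraidMonoid n) = σ a * braidOf w := by simp [braidOf]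
    rw [h, Submonoid.coe_mul, map_mul, ih, List.length_cons]
    have h1 : lengthHom n (σ a : BraidMonoid n) = Multiplicative.ofAdd (1 : ℤ) := by
      simp [lengthHom, σ]
    rw [h1, ← ofAdd_add]
    congr 1
    push_cast
    ring

theorem braidOf_surjective {n : ℕ} (β : BraidMonoid n) :
    ∃ w : List (Fin (n - 1)), braidOf w = β := by
  obtain ⟨β, hβ⟩ := β
  induction hβ using Submonoid.closure_induction with
  | mem x hx =>
    obtain ⟨i, rfl⟩ := hx
    exact ⟨[i], by simp [braidOf, σ]⟩
  | one => exact ⟨[], rfl⟩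
  | mul x y hx hy ihx ihy =>
    obtain ⟨u, hu⟩ := ihx
    obtain ⟨v, hv⟩ := ihy
    refine ⟨u ++ v, ?_⟩
    have : (braidOf (u ++ v) : BraidMonoid n) = braidOf u * braidOf v := by simp [braidOf]
    rw [this, hu, hv]
    rfl

/-- Every positive braid has a lexicographically least representative word. (All the words
representing a given braid have the same length; `≤` on lists is the lexicographic order.) -/
theorem exists_lexRep {n : ℕ} (β : BraidMonoid n) :
    ∃ w : List (Fin (n - 1)), IsLeast {u | braidOf u = β} w := by
  obtain ⟨w, hw⟩ := braidOf_surjective β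
  have hfin : {u : List (Fin (n - 1)) | braidOf u = β}.Finite := by
    refine (List.finite_length_eq (Fin (n - 1)) w.length).subset ?_
    intro u hu
    have h1 := lengthHom_braidOf u
    have h2 := lengthHom_braidOf w
    rw [Set.mem_ofPred_eq] at hu
    rw [hu] at h1
    rw [hw, h1] at h2
    exact_mod_cast Multiplicative.ofAdd.injective h2
  obtain ⟨m, hm, hmin⟩ := hfin.exists_minimal ⟨w, hw⟩
  exact ⟨m, hm, fun u hu => (le_total m u).elim id (fun h => hmin hu h)⟩

/-- The lex-representative of a positive braid. -/
noncomputable def lexRep {n : ℕ} (β : BraidMonoid n) : List (Fin (n - 1)) :=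
  (exists_lexRep β).choose

/-- The language of lex-representatives. -/
def lexLanguage (n : ℕ) : Language (Fin (n - 1)) :=
  {w | ∃ β : BraidMonoid n, lexRep β = w}

/-- The set of forbidden prefixes after the word `w`. -/
def forbidden {n : ℕ} (w : List (Fin (n - 1))) : Set (BraidMonoid n) :=
  {α | w ++ lexRep α ∉ lexLanguage n}

/-- The minimal elements of `X` with respect to the prefix order. In a monoid, `a ∣ b` means
`∃ c, b = a * c`, so that here `a ∣ b` says that `a` is a prefix of `b`. -/
def minPrefixes {n : ℕ} (X : Set (BraidMonoid n)) : Set (BraidMonoid n) :=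
  {x | x ∈ X ∧ ∀ y ∈ X, y ∣ x → y = x}

/-- The set of minimal forbidden prefixes after the word `w`. -/
def minForbidden {n : ℕ} (w : List (Fin (n - 1))) : Set (BraidMonoid n) :=
  minPrefixes (forbidden w)

/-- `m` is the least common multiple of `a` and `b` with respect to the prefix order. -/
def IsLcm {n : ℕ} (a b m : BraidMonoid n) : Prop :=
  a ∣ m ∧ b ∣ m ∧ ∀ m', a ∣ m' → b ∣ m' → m ∣ m'

/-- `c = a \ b`, that is, `a * c` is the least common multiple of `a` and `b`. -/
def IsResidual {n : ℕ} (a b c : BraidMonoid n) : Prop := IsLcm a b (a * c)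

/-- The fail state: the set of all Artin generators. -/
def failState (n : ℕ) : Set (BraidMonoid n) := Set.range σ

/-- The states: the sets of minimal forbidden prefixes, and the fail state. -/
def states (n : ℕ) : Set (Set (BraidMonoid n)) :=
  {S | ∃ w ∈ lexLanguage n, S = minForbidden w} ∪ {failState n}

open Classical in
/-- The transition rule. In the second case, the three sets are `{σ_1, …, σ_(i-2)}`,
`{σ_(i-1) σ_i}` (empty if `i` is the first index) and `{σ_i \ β | β ∈ S}`. -/
noncomputable def trans {n : ℕ} (S : Set (BraidMonoid n)) (i : Fin (n - 1)) :
    Set (BraidMonoid n) :=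
  if σ i ∈ S then failState n
  else minPrefixes
    ({x | ∃ k : Fin (n - 1), (k : ℕ) + 1 < i ∧ x = σ k} ∪
     {x | ∃ k : Fin (n - 1), (k : ℕ) + 1 = i ∧ x = σ k * σ i} ∪
     {c | ∃ β ∈ S, IsResidual (σ i) β c})

theorem lexRep_one {n : ℕ} : lexRep (1 : BraidMonoid n) = [] := by
  have h := (exists_lexRep (1 : BraidMonoid n)).choose_spec.1
  have h1 := lengthHom_braidOf (lexRep (1 : BraidMonoid n))
  change braidOf (lexRep (1 : BraidMonoid n)) = 1 at h
  rw [h] at h1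
  simp only [OneMemClass.coe_one, map_one] at h1
  have h2 := Multiplicative.ofAdd.injective (h1 : Multiplicative.ofAdd (0 : ℤ) = _)
  exact List.length_eq_zero_iff.1 (by exact_mod_cast h2.symm)

theorem minForbidden_nil {n : ℕ} : minForbidden ([] : List (Fin (n - 1))) = ∅ := by
  ext x
  simp only [minForbidden, minPrefixes, forbidden, Set.mem_ofPred_eq, List.nil_append,
    Set.mem_empty_iff_false, iff_false]
  exact fun h => h.1 ⟨x, rfl⟩

theorem empty_mem_states (n : ℕ) : ∅ ∈ states n :=
  Or.inl ⟨[], ⟨1, lexRep_one⟩, minForbidden_nil.symm⟩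

/-- The automaton with the states and transitions above, given that the transition rule maps states
to states. -/
noncomputable def Gamma (n : ℕ) (h : ∀ S ∈ states n, ∀ i : Fin (n - 1), trans S i ∈ states n) :
    DFA (Fin (n - 1)) (states n) where
  step S i := ⟨trans S.1 i, h S.1 S.2 i⟩
  start := ⟨∅, empty_mem_states n⟩
  accept := {S | S.1 ≠ failState n}

end PosBraid

/-! The automaton works because forbidden prefixes propagate letter by letter. Since $L_n$ is closed
under factors, $\alpha$ is forbidden after $w\sigma_i$ exactly when $\sigma_i\alpha$ is forbidden
after $w$ or some $\sigma_k$ with $k<i$ is a prefix of $\sigma_i\alpha$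
(`mem_forbidden_append_singleton`). Forbidden sets are closed under right multiples, so their
minimal elements determine them, and lcms turn this recursion into the transition rule
(`trans_minForbidden`).

Finiteness comes from the Garside element $\Delta$: every minimal forbidden prefix divides $\Delta$
(`dvd_garside_of_mem_minForbidden`), since suffixes of $\Delta$ are prefixes of $\Delta$. As no
$\sigma_i^2$ is a prefix of $\Delta$, the fail state is never a set of minimal forbidden prefixes
(`minForbidden_ne_failState`). Minimality is a Myhill–Nerode argument: words with the same right
quotient of $L_n$ have the same forbidden set.

The Garside theory needed is built for the monoid presented by the Artin relations: Garside's lemma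
(`ArtinMonoid.completes`), which gives cancellation and lcms of generators, and the half twist,
which gives common multiples. Ore fractions then identify that monoid with the submonoid of the
braid group (`toBraid_injective`). -/

namespace PosBraid

/-! ### The Artin monoid: Garside's lemma and cancellation. -/

/-- Two indices of Artin generators that differ by at least two. -/
def Far {m : ℕ} (i j : Fin m) : Prop := (i : ℕ) + 1 < j ∨ (j : ℕ) + 1 < i

/-- Two indices of Artin generators that differ by exactly one. -/
def Adj {m : ℕ} (i j : Fin m) : Prop := (i : ℕ) + 1 = j ∨ (j : ℕ) + 1 = i

theorem Far.symm {m : ℕ} {i j : Fin m} (h : Far i j) : Far j i := Or.symm h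

theorem Adj.symm {m : ℕ} {i j : Fin m} (h : Adj i j) : Adj j i := Or.symm h

theorem eq_or_far_or_adj {m : ℕ} (i j : Fin m) : i = j ∨ Far i j ∨ Adj i j := by
  unfold Far Adj
  rw [Fin.ext_iff]
  omega

/-- A single application of an Artin relation to a positive word. -/
inductive ArtinStep (m : ℕ) : List (Fin m) → List (Fin m) → Prop
  | comm (a b : List (Fin m)) (i j : Fin m) (h : Far i j) :
      ArtinStep m (a ++ i :: j :: b) (a ++ j :: i :: b)
  | braid (a b : List (Fin m)) (i j : Fin m) (h : Adj i j) :
      ArtinStep m (a ++ i :: j :: i :: b) (a ++ j :: i :: j :: b)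

theorem ArtinStep.append {m : ℕ} {u v : List (Fin m)} (h : ArtinStep m u v)
    (a b : List (Fin m)) : ArtinStep m (a ++ u ++ b) (a ++ v ++ b) := by
  cases h with
  | comm c d i j h => simpa using ArtinStep.comm (a ++ c) (d ++ b) i j h
  | braid c d i j h => simpa using ArtinStep.braid (a ++ c) (d ++ b) i j h

theorem ArtinStep.reverse {m : ℕ} {u v : List (Fin m)} (h : ArtinStep m u v) :
    ArtinStep m u.reverse v.reverse := by
  cases h with
  | comm c d i j h => simpa using ArtinStep.comm d.reverse c.reverse j i h.symm
  | braid c d i j h => simpa using ArtinStep.braid d.reverse c.reverse i j h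

theorem eqvGen_append {m : ℕ} {u v : List (Fin m)}
    (h : Relation.EqvGen (ArtinStep m) u v) (a b : List (Fin m)) :
    Relation.EqvGen (ArtinStep m) (a ++ u ++ b) (a ++ v ++ b) := by
  induction h with
  | rel x y h => exact .rel _ _ (h.append a b)
  | refl x => exact .refl _
  | symm x y _ ih => exact .symm _ _ ih
  | trans x y z _ _ ih1 ih2 => exact .trans _ _ _ ih1 ih2

/-- The congruence on positive words generated by the Artin relations. -/
def artinCon (m : ℕ) : Con (FreeMonoid (Fin m)) where
  r u v := Relation.EqvGen (ArtinStep m) u.toList v.toList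
  iseqv := ⟨fun _ => .refl _, fun h => .symm _ _ h, fun h k => .trans _ _ _ h k⟩
  mul' {w x y z} h k := by
    have h1 := eqvGen_append h [] y.toList
    have h2 := eqvGen_append k x.toList []
    rw [List.nil_append, List.nil_append] at h1
    rw [List.append_nil, List.append_nil] at h2
    simpa using h1.trans _ _ _ h2

/-- The monoid presented by the Artin relations. -/
abbrev ArtinMonoid (m : ℕ) : Type := (artinCon m).Quotient

namespace ArtinMonoid

variable {m : ℕ}

/-- The element represented by a word. -/
def mk (w : List (Fin m)) : ArtinMonoid m := ((FreeMonoid.ofList w : FreeMonoid (Fin m)) :)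

/-- The generators. -/
def gen (i : Fin m) : ArtinMonoid m := mk [i]

theorem mk_nil : mk ([] : List (Fin m)) = 1 := rfl

theorem mk_append (u v : List (Fin m)) : mk (u ++ v) = mk u * mk v := rfl

theorem mk_cons (i : Fin m) (v : List (Fin m)) : mk (i :: v) = gen i * mk v := rfl

theorem mk_surjective (x : ArtinMonoid m) : ∃ w, mk w = x := by
  induction x using Con.induction_on with
  | _ w => exact ⟨w.toList, rfl⟩

theorem mk_eq_mk {u v : List (Fin m)} :
    mk u = mk v ↔ Relation.EqvGen (ArtinStep m) u v := by
  unfold mk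
  rw [Con.eq]
  rfl

theorem gen_comm {i j : Fin m} (h : Far i j) (z : ArtinMonoid m) :
    gen i * (gen j * z) = gen j * (gen i * z) := by
  obtain ⟨w, rfl⟩ := mk_surjective z
  exact mk_eq_mk.2 (.rel _ _ (ArtinStep.comm [] w i j h))

theorem gen_braid {i j : Fin m} (h : Adj i j) (z : ArtinMonoid m) :
    gen i * (gen j * (gen i * z)) = gen j * (gen i * (gen j * z)) := by
  obtain ⟨w, rfl⟩ := mk_surjective z
  exact mk_eq_mk.2 (.rel _ _ (ArtinStep.braid [] w i j h))

/-- The universal property of the Artin monoid. -/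
def lift {X : Type*} [Monoid X] (f : Fin m → X)
    (hc : ∀ i j, Far i j → f i * f j = f j * f i)
    (hb : ∀ i j, Adj i j → f i * f j * f i = f j * f i * f j) : ArtinMonoid m →* X :=
  Con.lift (artinCon m) (FreeMonoid.lift f) (by
    intro u v h0
    change FreeMonoid.lift f (FreeMonoid.ofList u.toList) =
      FreeMonoid.lift f (FreeMonoid.ofList v.toList)
    have h : Relation.EqvGen (ArtinStep m) u.toList v.toList := h0
    clear h0
    generalize u.toList = u, v.toList = v at h
    induction h with
    | rel x y h =>
      cases h with
      | comm a b i j h =>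
        simp only [FreeMonoid.lift_ofList, List.map_append, List.map_cons, List.prod_append,
          List.prod_cons]
        rw [← mul_assoc (f i), hc i j h, mul_assoc]
      | braid a b i j h =>
        simp only [FreeMonoid.lift_ofList, List.map_append, List.map_cons, List.prod_append,
          List.prod_cons]
        rw [← mul_assoc (f j), ← mul_assoc (f i), ← mul_assoc (f i), hb i j h]
        simp only [mul_assoc]
    | refl x => rfl
    | symm x y _ ih => exact ih.symm
    | trans x y z h1 h2 ih1 ih2 => exact ih1.trans ih2)

theorem lift_mk {X : Type*} [Monoid X] (f : Fin m → X) (hc hb) (w : List (Fin m)) :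
    lift f hc hb (mk w) = (w.map f).prod := by
  change FreeMonoid.lift f (FreeMonoid.ofList w) = _
  rw [FreeMonoid.lift_ofList]

theorem lift_gen {X : Type*} [Monoid X] (f : Fin m → X) (hc hb) (i : Fin m) :
    lift f hc hb (gen i) = f i := by
  rw [gen, lift_mk]
  simp

/-- The word length. -/
def len (x : ArtinMonoid m) : ℕ :=
  Multiplicative.toAdd (lift (fun _ => Multiplicative.ofAdd 1) (fun _ _ _ => rfl)
    (fun _ _ _ => rfl) x)

theorem len_mul (x y : ArtinMonoid m) : len (x * y) = len x + len y := by
  simp [len]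

theorem len_gen (i : Fin m) : len (gen i) = 1 := by
  simp [len, lift_gen]

/-- The relation between `x` and `y` that characterizes the equality `gen i * x = gen j * y`. -/
def Completes (i j : Fin m) (x y : ArtinMonoid m) : Prop :=
  (i = j ∧ x = y) ∨ (Far i j ∧ ∃ z, x = gen j * z ∧ y = gen i * z) ∨
    (Adj i j ∧ ∃ z, x = gen j * (gen i * z) ∧ y = gen i * (gen j * z))

theorem Completes.symm {i j : Fin m} {x y : ArtinMonoid m} (h : Completes i j x y) :
    Completes j i y x := by
  rcases h with ⟨h, h1⟩ | ⟨h, z, h1, h2⟩ | ⟨h, z, h1, h2⟩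
  · exact .inl ⟨h.symm, h1.symm⟩
  · exact .inr (.inl ⟨h.symm, z, h2, h1⟩)
  · exact .inr (.inr ⟨h.symm, z, h2, h1⟩)

theorem Completes.eq {i : Fin m} {x y : ArtinMonoid m} (h : Completes i i x y) : x = y := by
  rcases h with ⟨h, h1⟩ | ⟨h, z, h1, h2⟩ | ⟨h, z, h1, h2⟩
  · exact h1
  · exact absurd h (by unfold Far; omega)
  · exact absurd h (by unfold Adj; omega)

theorem Completes.far {i j : Fin m} {x y : ArtinMonoid m} (h : Completes i j x y)
    (hf : Far i j) : ∃ z, x = gen j * z ∧ y = gen i * z := by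
  rcases h with ⟨rfl, -⟩ | ⟨-, h⟩ | ⟨h, -⟩
  · exact absurd hf (by unfold Far; omega)
  · exact h
  · exact absurd hf (by unfold Far Adj at *; omega)

theorem Completes.adj {i j : Fin m} {x y : ArtinMonoid m} (h : Completes i j x y)
    (hf : Adj i j) : ∃ z, x = gen j * (gen i * z) ∧ y = gen i * (gen j * z) := by
  rcases h with ⟨rfl, -⟩ | ⟨h, -⟩ | ⟨-, h⟩
  · exact absurd hf (by unfold Adj; omega)
  · exact absurd hf (by unfold Far Adj at *; omega)
  · exact h

theorem Completes.trans_far_far {l : ℕ}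
    (H : ∀ (i j : Fin m) (x y : ArtinMonoid m), len x < l → gen i * x = gen j * y →
      Completes i j x y)
    {i j k : Fin m} {z z' : ArtinMonoid m} (hl : len z < l) (h1 : Far i j) (h2 : Far j k)
    (e : gen i * z = gen k * z') : Completes i k (gen j * z) (gen j * z') := by
  have c := H _ _ _ _ hl e
  rcases eq_or_far_or_adj i k with rfl | h3 | h3
  · rw [c.eq]; exact .inl ⟨rfl, rfl⟩
  · obtain ⟨a, rfl, rfl⟩ := c.far h3
    exact .inr (.inl ⟨h3, gen j * a, gen_comm h2 _, gen_comm h1.symm _⟩)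
  · obtain ⟨a, rfl, rfl⟩ := c.adj h3
    refine .inr (.inr ⟨h3, gen j * a, ?_, ?_⟩)
    · rw [gen_comm h2, gen_comm h1.symm]
    · rw [gen_comm h1.symm, gen_comm h2]

/-- Only `Adj i k` is substantial: the indices then form the path `i`, `k`, `j`. Applying `H` to
shorter and shorter equations peels off letters until both sides become the half twist on four
strands times a common `d`. -/
theorem Completes.trans_far_adj {l : ℕ}
    (H : ∀ (i j : Fin m) (x y : ArtinMonoid m), len x < l → gen i * x = gen j * y →
      Completes i j x y)
    {i j k : Fin m} {z z' : ArtinMonoid m} (hl : len z < l) (h1 : Far i j) (h2 : Adj j k)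
    (e : gen i * z = gen k * (gen j * z')) :
    Completes i k (gen j * z) (gen j * (gen k * z')) := by
  have c := H _ _ _ _ hl e
  have hm := congrArg len e
  simp only [len_mul, len_gen] at hm
  rcases eq_or_far_or_adj i k with rfl | h3 | h3
  · exact absurd h1 (by unfold Far Adj at *; omega)
  · obtain ⟨a, rfl, q⟩ := c.far h3
    simp only [len_mul, len_gen] at hm hl
    obtain ⟨b, rfl, rfl⟩ := (H _ _ _ _ (by omega) q).far h1.symm
    refine .inr (.inl ⟨h3, gen j * (gen k * b), ?_, ?_⟩)
    · rw [gen_braid h2]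
    · rw [gen_comm h3.symm, gen_comm h1.symm]
  · obtain ⟨a, rfl, q⟩ := c.adj h3
    simp only [len_mul, len_gen] at hm hl
    obtain ⟨b, rfl, q'⟩ := (H _ _ _ _ (by omega) q).far h1.symm
    simp only [len_mul, len_gen] at hm hl
    obtain ⟨d, rfl, rfl⟩ := (H _ _ _ _ (by omega) q').adj h2.symm
    refine .inr (.inr ⟨h3, gen j * (gen k * (gen i * d)), ?_, ?_⟩)
    · rw [gen_comm h1, gen_braid h2, gen_braid h3.symm, gen_comm h1.symm]
    · rw [gen_braid h3.symm, gen_comm h1 d, gen_comm h1.symm, gen_braid h2]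

theorem Completes.trans_adj_adj {l : ℕ}
    (H : ∀ (i j : Fin m) (x y : ArtinMonoid m), len x < l → gen i * x = gen j * y →
      Completes i j x y)
    {i j k : Fin m} {z z' : ArtinMonoid m} (hl : len z + 1 < l) (h1 : Adj i j) (h2 : Adj j k)
    (e : gen i * (gen j * z) = gen k * (gen j * z')) :
    Completes i k (gen j * (gen i * z)) (gen j * (gen k * z')) := by
  have c := H _ _ _ _ (by rw [len_mul, len_gen]; omega) e
  have hm := congrArg len e
  simp only [len_mul, len_gen] at hm
  rcases eq_or_far_or_adj i k with rfl | h3 | h3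
  · rw [(H _ _ _ _ (by omega) c.eq).eq]
    exact .inl ⟨rfl, rfl⟩
  · obtain ⟨p, q, q'⟩ := c.far h3
    obtain ⟨r, rfl, rfl⟩ := (H _ _ _ _ (by omega) q).adj h2
    simp only [len_mul, len_gen] at hm hl
    obtain ⟨s, rfl, q3⟩ := (H _ _ _ _ (by omega) q').adj h1.symm
    simp only [len_mul, len_gen] at hm hl
    have q4 := H _ _ _ _ (by rw [len_mul, len_gen]; omega) q3
    obtain ⟨t, rfl, rfl⟩ := (H _ _ _ _ (by omega) q4.eq).far h3.symm
    refine .inr (.inl ⟨h3, gen j * (gen k * (gen i * (gen j * t))), ?_, ?_⟩)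
    · rw [gen_comm h3, gen_braid h1, gen_braid h2]
    · rw [gen_comm h3.symm, gen_braid h2.symm, gen_braid h1.symm, gen_comm h3]
  -- The Coxeter graph is a path and contains no triangle.
  · exact absurd h1 (by unfold Adj at *; omega)

/-- The heart of Garside's lemma: two lcm-shaped equations sharing the middle term `y` compose. The
two expressions of `y` give an equation with a strictly shorter tail, to which `H` applies; what
remains is a check on at most three generators. -/
theorem Completes.trans {l : ℕ}
    (H : ∀ (i j : Fin m) (x y : ArtinMonoid m), len x < l → gen i * x = gen j * y →
      Completes i j x y)
    {i j k : Fin m} {x y t : ArtinMonoid m} (hy : len y ≤ l)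
    (h1 : Completes i j x y) (h2 : Completes j k y t) : Completes i k x t := by
  rcases h1 with ⟨rfl, rfl⟩ | ⟨h1, z, rfl, e⟩ | ⟨h1, z, rfl, e⟩
  · exact h2
  · have hl : len z < l := by rw [e, len_mul, len_gen] at hy; omega
    rcases h2 with ⟨rfl, rfl⟩ | ⟨h2, z', e', rfl⟩ | ⟨h2, z', e', rfl⟩
    · exact .inr (.inl ⟨h1, z, rfl, e⟩)
    · exact trans_far_far H hl h1 h2 (e.symm.trans e')
    · exact trans_far_adj H hl h1 h2 (e.symm.trans e')
  · rcases h2 with ⟨rfl, rfl⟩ | ⟨h2, z', e', rfl⟩ | ⟨h2, z', e', rfl⟩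
    · exact .inr (.inr ⟨h1, z, rfl, e⟩)
    · have hl : len z' < l := by rw [e', len_mul, len_gen] at hy; omega
      exact (trans_far_adj H hl h2.symm h1.symm (e'.symm.trans e)).symm
    · refine trans_adj_adj H ?_ h1 h2 (e.symm.trans e')
      rw [e, len_mul, len_mul, len_gen, len_gen] at hy
      omega

theorem length_eq_of_eqvGen {u v : List (Fin m)} (h : Relation.EqvGen (ArtinStep m) u v) :
    u.length = v.length := by
  induction h with
  | rel x y h => cases h <;> simp
  | refl x => rfl
  | symm x y _ ih => exact ih.symm
  | trans x y z _ _ ih1 ih2 => exact ih1.trans ih2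

theorem len_mk (u : List (Fin m)) : len (mk u) = u.length := by
  simp [len, lift_mk]

theorem _root_.PosBraid.ArtinStep.completes {i j : Fin m} {u v : List (Fin m)}
    (h : ArtinStep m (i :: u) (j :: v)) : Completes i j (mk u) (mk v) := by
  generalize hu : i :: u = u' at h
  generalize hv : j :: v = v' at h
  cases h with
  | comm a b k l h =>
    cases a with
    | nil =>
      obtain ⟨rfl, rfl⟩ := List.cons_eq_cons.1 hu
      obtain ⟨rfl, rfl⟩ := List.cons_eq_cons.1 hv
      exact .inr (.inl ⟨h, mk b, rfl, rfl⟩)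
    | cons c a =>
      obtain ⟨rfl, rfl⟩ := List.cons_eq_cons.1 hu
      obtain ⟨rfl, rfl⟩ := List.cons_eq_cons.1 hv
      exact .inl ⟨rfl, mk_eq_mk.2 (.rel _ _ (.comm a b k l h))⟩
  | braid a b k l h =>
    cases a with
    | nil =>
      obtain ⟨rfl, rfl⟩ := List.cons_eq_cons.1 hu
      obtain ⟨rfl, rfl⟩ := List.cons_eq_cons.1 hv
      exact .inr (.inr ⟨h, mk b, rfl, rfl⟩)
    | cons c a =>
      obtain ⟨rfl, rfl⟩ := List.cons_eq_cons.1 hu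
      obtain ⟨rfl, rfl⟩ := List.cons_eq_cons.1 hv
      exact .inl ⟨rfl, mk_eq_mk.2 (.rel _ _ (.braid a b k l h))⟩

/-- Follows a chain of Artin steps between two words. Steps preserve length, so every intermediate
word has a first letter and the links can be composed. -/
theorem completes_of_eqvGen {l : ℕ}
    (H : ∀ (i j : Fin m) (x y : ArtinMonoid m), len x < l → gen i * x = gen j * y →
      Completes i j x y) {u v : List (Fin m)} (h : Relation.EqvGen (ArtinStep m) u v) :
    ∀ i j u' v', u = i :: u' → v = j :: v' → u'.length ≤ l → Completes i j (mk u') (mk v') := by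
  induction h with
  | rel x y h => rintro i j u' v' rfl rfl -; exact h.completes
  | refl x =>
    rintro i j u' v' rfl h -
    obtain ⟨rfl, rfl⟩ := List.cons_eq_cons.1 h
    exact .inl ⟨rfl, rfl⟩
  | symm x y h ih =>
    intro i j u' v' hu hv hl
    have := length_eq_of_eqvGen h
    rw [hu, hv, List.length_cons, List.length_cons] at this
    exact (ih j i v' u' hv hu (by omega)).symm
  | trans x y z h h' ih1 ih2 =>
    intro i j u' v' hu hv hl
    have := length_eq_of_eqvGen h
    cases y with
    | nil => simp [hu] at this
    | cons k y =>
      rw [hu, List.length_cons, List.length_cons] at this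
      exact Completes.trans H (by rw [len_mk]; omega) (ih1 i k u' y hu rfl hl)
        (ih2 k j y v' rfl hv (by omega))

theorem completes_of_length (l : ℕ) : ∀ (i j : Fin m) (x y : ArtinMonoid m), len x < l →
    gen i * x = gen j * y → Completes i j x y := by
  induction l with
  | zero => exact fun _ _ _ _ h => absurd h (by omega)
  | succ l H =>
    intro i j x y hx e
    obtain ⟨u, rfl⟩ := mk_surjective x
    obtain ⟨v, rfl⟩ := mk_surjective y
    rw [len_mk] at hx
    exact completes_of_eqvGen H (mk_eq_mk.1 e) i j u v rfl rfl (by omega)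

theorem completes {i j : Fin m} {x y : ArtinMonoid m} (h : gen i * x = gen j * y) :
    Completes i j x y :=
  completes_of_length (len x + 1) i j x y (Nat.lt_succ_self _) h

theorem mul_left_cancel' {a x y : ArtinMonoid m} (h : a * x = a * y) : x = y := by
  obtain ⟨u, rfl⟩ := mk_surjective a
  induction u with
  | nil => simpa [mk_nil] using h
  | cons i u ih =>
    rw [mk_cons, mul_assoc, mul_assoc] at h
    exact ih (completes h).eq

theorem mk_reverse {u v : List (Fin m)} (h : mk u = mk v) : mk u.reverse = mk v.reverse := by
  rw [mk_eq_mk] at h ⊢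
  induction h with
  | rel x y h => exact .rel _ _ h.reverse
  | refl x => exact .refl _
  | symm x y _ ih => exact .symm _ _ ih
  | trans x y z _ _ ih1 ih2 => exact .trans _ _ _ ih1 ih2

/-- The Artin relations are stable under reversing words, which turns left cancellation into right
cancellation. -/
theorem mul_right_cancel' {a x y : ArtinMonoid m} (h : x * a = y * a) : x = y := by
  obtain ⟨u, rfl⟩ := mk_surjective a
  obtain ⟨v, rfl⟩ := mk_surjective x
  obtain ⟨w, rfl⟩ := mk_surjective y
  rw [← mk_append, ← mk_append] at h
  have h := mk_reverse h
  rw [List.reverse_append, List.reverse_append, mk_append, mk_append] at h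
  simpa using mk_reverse (mul_left_cancel' h)

end ArtinMonoid
end PosBraid

/-! ### The half twist: common multiples and square-freeness. -/

namespace PosBraid
namespace ArtinMonoid

variable {m : ℕ}

/-- The generators, indexed by natural numbers (trivial outside of the range). -/
def atom (m k : ℕ) : ArtinMonoid m := if h : k < m then gen ⟨k, h⟩ else 1

theorem atom_of_lt {k : ℕ} (h : k < m) : atom m k = gen ⟨k, h⟩ := dif_pos h

theorem atom_val (i : Fin m) : atom m i = gen i := dif_pos i.2

theorem atom_comm {i j : ℕ} (h : i + 1 < j) (z : ArtinMonoid m) :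
    atom m i * (atom m j * z) = atom m j * (atom m i * z) := by
  by_cases hj : j < m
  · rw [atom_of_lt hj, atom_of_lt (by omega : i < m)]
    exact gen_comm (.inl h) z
  · simp [atom, hj]

theorem atom_comm' {i j : ℕ} (h : i + 1 < j) : atom m i * atom m j = atom m j * atom m i := by
  simpa using atom_comm h (1 : ArtinMonoid m)

theorem atom_braid {i : ℕ} (h : i + 1 < m) (z : ArtinMonoid m) :
    atom m i * (atom m (i + 1) * (atom m i * z)) =
      atom m (i + 1) * (atom m i * (atom m (i + 1) * z)) := by
  rw [atom_of_lt h, atom_of_lt (by omega : i < m)]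
  exact gen_braid (.inl rfl) z

theorem atom_completes_far {i j : ℕ} (h : i + 1 < j) (hj : j < m) {x y : ArtinMonoid m}
    (e : atom m i * x = atom m j * y) : ∃ z, x = atom m j * z ∧ y = atom m i * z := by
  rw [atom_of_lt hj, atom_of_lt (by omega : i < m)] at e ⊢
  exact (completes e).far (.inl h)

theorem atom_completes_adj {i : ℕ} (h : i + 1 < m) {x y : ArtinMonoid m}
    (e : atom m i * x = atom m (i + 1) * y) :
    ∃ z, x = atom m (i + 1) * (atom m i * z) ∧ y = atom m i * (atom m (i + 1) * z) := by
  rw [atom_of_lt h, atom_of_lt (by omega : i < m)] at e ⊢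
  exact (completes e).adj (.inl rfl)

/-- The product of the atoms with indices `j, …, j + l - 1` in ascending order. -/
def asc (m : ℕ) : ℕ → ℕ → ArtinMonoid m
  | _, 0 => 1
  | j, l + 1 => atom m j * asc m (j + 1) l

/-- The product of the atoms with indices `k - 1, …, 0` in descending order. -/
def desc (m : ℕ) : ℕ → ArtinMonoid m
  | 0 => 1
  | k + 1 => atom m k * desc m k

/-- The half twist on the first `k + 1` strands. -/
def halfTwist (m : ℕ) : ℕ → ArtinMonoid m
  | 0 => 1
  | k + 1 => asc m 0 (k + 1) * halfTwist m k

theorem asc_add (j k l : ℕ) : asc m j (k + l) = asc m j k * asc m (j + k) l := by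
  induction k generalizing j with
  | zero => simp [asc]
  | succ k ih =>
    rw [Nat.add_right_comm, asc, asc, ih, mul_assoc, Nat.add_right_comm, Nat.add_assoc]

theorem asc_succ (j k : ℕ) : asc m j (k + 1) = asc m j k * atom m (j + k) := by
  rw [asc_add]
  simp [asc]

theorem atom_asc_comm {j k i : ℕ} (h : j + k < i) :
    atom m i * asc m j k = asc m j k * atom m i := by
  induction k with
  | zero => simp [asc]
  | succ k ih =>
    rw [asc_succ, ← mul_assoc, ih (by omega), mul_assoc, mul_assoc,
      atom_comm' (by omega : j + k + 1 < i)]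

theorem atom_desc_comm {k i : ℕ} (h : k < i) : atom m i * desc m k = desc m k * atom m i := by
  induction k with
  | zero => simp [desc]
  | succ k ih => rw [desc, mul_assoc, ← ih (by omega), atom_comm (by omega : k + 1 < i)]

theorem atom_halfTwist_comm {k i : ℕ} (h : k < i) :
    atom m i * halfTwist m k = halfTwist m k * atom m i := by
  induction k with
  | zero => simp [halfTwist]
  | succ k ih =>
    rw [halfTwist, mul_assoc, ← ih (by omega), ← mul_assoc, ← mul_assoc, atom_asc_comm (by omega)]

theorem atom_succ_mul_asc {i k : ℕ} (h : i + 1 < k) (hk : k ≤ m) :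
    atom m (i + 1) * asc m 0 k = asc m 0 k * atom m i := by
  induction k with
  | zero => omega
  | succ k ih =>
    rcases Nat.lt_or_ge (i + 1) k with h' | h'
    · rw [asc_succ, ← mul_assoc, ih h' (by omega), mul_assoc, mul_assoc, Nat.zero_add,
        atom_comm' h']
    · obtain rfl : k = i + 1 := by omega
      have := atom_braid (by omega : i + 1 < m) 1
      simp only [mul_one] at this
      rw [asc_succ, asc_succ, Nat.zero_add, Nat.zero_add, ← mul_assoc, ← mul_assoc,
        atom_asc_comm (by omega), mul_assoc, mul_assoc, ← this]
      simp only [mul_assoc]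

theorem atom_mul_desc {i k : ℕ} (h : i + 1 < k) (hk : k ≤ m) :
    atom m i * desc m k = desc m k * atom m (i + 1) := by
  induction k with
  | zero => omega
  | succ k ih =>
    rcases Nat.lt_or_ge (i + 1) k with h' | h'
    · rw [desc, atom_comm h', ih h' (by omega), mul_assoc]
    · obtain rfl : k = i + 1 := by omega
      rw [desc, desc, atom_braid (by omega), atom_desc_comm (by omega)]
      simp only [mul_assoc]

/-- A second factorization, needed to move the first generator across the half twist: the ascending
one only shifts the generators of positive index. -/
theorem halfTwist_succ (k : ℕ) : halfTwist m (k + 1) = halfTwist m k * desc m (k + 1) := by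
  induction k with
  | zero => simp [halfTwist, asc, desc]
  | succ k ih =>
    rw [halfTwist, desc, ← mul_assoc (halfTwist m (k + 1)), halfTwist, asc_succ, Nat.zero_add,
      mul_assoc, mul_assoc, mul_assoc, ← mul_assoc (halfTwist m k), ← atom_halfTwist_comm (by omega),
      mul_assoc, ← ih, halfTwist]

theorem atom_mul_halfTwist {i k : ℕ} (h : i < k) (hk : k ≤ m) :
    atom m i * halfTwist m k = halfTwist m k * atom m (k - 1 - i) := by
  induction k generalizing i with
  | zero => omega
  | succ k ih =>
    cases i with
    | zero =>
      cases k with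
      | zero => simp [halfTwist, asc]
      | succ k =>
        rw [halfTwist_succ, ← mul_assoc, ih (by omega) (by omega), mul_assoc, mul_assoc,
          atom_mul_desc (by omega) hk]
        rfl
    | succ i =>
      rw [halfTwist, ← mul_assoc, atom_succ_mul_asc (by omega) hk, mul_assoc,
        ih (by omega) (by omega), mul_assoc]
      congr 3
      omega

theorem atom_dvd_halfTwist {i k : ℕ} (h : i < k) (hk : k ≤ m) : atom m i ∣ halfTwist m k := by
  induction k generalizing i with
  | zero => omega
  | succ k ih =>
    cases i with
    | zero => exact ⟨_, by rw [halfTwist, asc, mul_assoc]⟩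
    | succ i =>
      obtain ⟨z, hz⟩ := ih (i := i) (by omega) (by omega)
      exact ⟨asc m 0 (k + 1) * z, by
        rw [halfTwist, hz, ← mul_assoc, ← mul_assoc, atom_succ_mul_asc (by omega) hk]⟩

theorem gen_dvd_halfTwist (i : Fin m) : gen i ∣ halfTwist m m :=
  atom_val i ▸ atom_dvd_halfTwist i.2 le_rfl

theorem exists_mul_halfTwist (x : ArtinMonoid m) :
    ∃ y, x * halfTwist m m = halfTwist m m * y := by
  obtain ⟨w, rfl⟩ := mk_surjective x
  induction w with
  | nil => exact ⟨1, by simp [mk_nil]⟩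
  | cons i w ih =>
    obtain ⟨y, hy⟩ := ih
    exact ⟨atom m (m - 1 - i) * y, by
      rw [mk_cons, mul_assoc, hy, ← mul_assoc, ← atom_val, atom_mul_halfTwist i.2 le_rfl, mul_assoc]⟩

/-- Write $x\Delta=\Delta z=xyz$ and cancel $x$. -/
theorem dvd_halfTwist_of_mul_eq {x y : ArtinMonoid m} (h : x * y = halfTwist m m) :
    y ∣ halfTwist m m := by
  obtain ⟨z, hz⟩ := exists_mul_halfTwist x
  refine ⟨z, mul_left_cancel' (a := x) ?_⟩
  rw [hz, ← h, mul_assoc]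

/-- Each new letter costs one factor $\Delta$: the complement of the earlier letters is moved past
$\Delta$, and the new letter is a prefix of $\Delta$. -/
theorem exists_dvd_halfTwist_pow (x : ArtinMonoid m) : ∃ k, x ∣ halfTwist m m ^ k := by
  obtain ⟨w, rfl⟩ := mk_surjective x
  induction w using List.reverseRecOn with
  | nil => exact ⟨0, by simp [mk_nil]⟩
  | append_singleton w i ih =>
    obtain ⟨k, z, hz⟩ := ih
    obtain ⟨y, hy⟩ := exists_mul_halfTwist z
    obtain ⟨t, ht⟩ := gen_dvd_halfTwist i
    refine ⟨k + 1, t * y, ?_⟩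
    change _ = mk w * gen i * (t * y)
    rw [pow_succ, hz, mul_assoc, hy, ht]
    simp only [mul_assoc]

theorem exists_mul_eq_mul (x y : ArtinMonoid m) : ∃ a b, x * a = y * b := by
  obtain ⟨k, a, ha⟩ := exists_dvd_halfTwist_pow x
  obtain ⟨l, b, hb⟩ := exists_dvd_halfTwist_pow y
  refine ⟨a * halfTwist m m ^ l, b * halfTwist m m ^ k, ?_⟩
  rw [← mul_assoc, ← mul_assoc, ← ha, ← hb, ← pow_add, ← pow_add, add_comm]

theorem exists_mul_eq_mul_left (x y : ArtinMonoid m) : ∃ a b, a * x = b * y := by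
  obtain ⟨u, rfl⟩ := mk_surjective x
  obtain ⟨v, rfl⟩ := mk_surjective y
  obtain ⟨a, b, h⟩ := exists_mul_eq_mul (mk u.reverse) (mk v.reverse)
  obtain ⟨a, rfl⟩ := mk_surjective a
  obtain ⟨b, rfl⟩ := mk_surjective b
  have := mk_reverse (u := u.reverse ++ a) (v := v.reverse ++ b) h
  rw [List.reverse_append, List.reverse_append, List.reverse_reverse, List.reverse_reverse] at this
  exact ⟨mk a.reverse, mk b.reverse, this⟩

theorem exists_of_atom_mul_eq_asc_mul {j k i : ℕ} (h : j + k < i) (hi : i < m)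
    {y z : ArtinMonoid m} (e : atom m i * y = asc m j k * z) :
    ∃ t, y = asc m j k * t ∧ z = atom m i * t := by
  induction k generalizing z with
  | zero => exact ⟨y, by simp [asc], by simpa [asc] using e.symm⟩
  | succ k ih =>
    rw [asc_succ, mul_assoc] at e
    obtain ⟨t, rfl, ht⟩ := ih (by omega) e
    obtain ⟨r, rfl, rfl⟩ := atom_completes_far (by omega) hi ht
    exact ⟨r, by rw [asc_succ, mul_assoc], rfl⟩

theorem exists_of_asc_mul_eq_atom_mul {i j l : ℕ} (h : i + 1 < j) (hl : j + l ≤ m)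
    {y z : ArtinMonoid m} (e : asc m j l * y = atom m i * z) : ∃ t, y = atom m i * t := by
  induction l generalizing j z with
  | zero => exact ⟨z, by simpa [asc] using e⟩
  | succ l ih =>
    rw [asc, mul_assoc] at e
    obtain ⟨t, -, ht⟩ := atom_completes_far h (by omega) e.symm
    exact ih (by omega) (by omega) ht

theorem exists_of_asc_zero_mul_eq_asc_mul {j l : ℕ} (hj : 1 ≤ j) (hl : j + l ≤ m)
    {y z : ArtinMonoid m} (e : asc m 0 j * z = asc m j l * y) :
    ∃ t, y = asc m 0 (j + l) * t := by
  induction l generalizing j z with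
  | zero => exact ⟨z, by simpa [asc] using e.symm⟩
  | succ l ih =>
    obtain ⟨j, rfl⟩ := Nat.exists_eq_add_of_le' hj
    rw [asc_succ 0 j, asc, Nat.zero_add, mul_assoc, mul_assoc] at e
    obtain ⟨t, ht, e⟩ := exists_of_atom_mul_eq_asc_mul (m := m) (j := 0) (k := j) (i := j + 1)
      (by omega) (by omega) e.symm
    obtain ⟨r, -, rfl⟩ := atom_completes_adj (m := m) (i := j) (by omega) e
    rw [Nat.add_comm l 1, ← Nat.add_assoc]
    refine ih (j := j + 1 + 1) (z := r) (by omega) (by omega) ?_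
    rw [ht, asc_succ, asc_succ, Nat.zero_add, Nat.zero_add, mul_assoc, mul_assoc]

/-- The homomorphism that detects the letter `k`. -/
def avoids (k : ℕ) : ArtinMonoid m →* ℕ :=
  lift (fun i => if (i : ℕ) = k then 0 else 1) (fun _ _ _ => mul_comm _ _) (fun i j _ => by
    split_ifs <;> rfl)

theorem avoids_atom {i k : ℕ} (h : i ≠ k) : avoids k (atom m i) = 1 := by
  unfold atom avoids
  split_ifs <;> simp [lift_gen, h]

theorem avoids_atom_self {k : ℕ} (h : k < m) : avoids k (atom m k) = 0 := by
  simp [atom_of_lt h, avoids, lift_gen]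

theorem avoids_asc {j l k : ℕ} (h : j + l ≤ k) : avoids k (asc m j l) = 1 := by
  induction l with
  | zero => simp [asc]
  | succ l ih => rw [asc_succ, map_mul, ih (by omega), avoids_atom (by omega)]

theorem avoids_halfTwist {j k : ℕ} (h : j ≤ k) : avoids k (halfTwist m j) = 1 := by
  induction j with
  | zero => simp [halfTwist]
  | succ j ih => rw [halfTwist, map_mul, ih (by omega), avoids_asc (by omega)]

/-- Induction on `i`: stripping the leading ascending product lowers both `i` and `k` by one, until
`i = 0`. -/
theorem not_atom_sq_dvd_halfTwist {i k : ℕ} (h : i < k) (hk : k ≤ m) (z : ArtinMonoid m) :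
    halfTwist m k ≠ atom m i * (atom m i * z) := by
  intro e
  induction i generalizing k z with
  | zero =>
    obtain ⟨k, rfl⟩ := Nat.exists_eq_add_of_le' h
    rw [halfTwist, asc, mul_assoc] at e
    have e := mul_left_cancel' e
    -- A square at index 0 would force the letter `k` into `halfTwist m k`, which uses only letters
    -- below `k`; `avoids k` takes the value 0 on one side and 1 on the other.
    obtain ⟨t, ht⟩ := exists_of_asc_zero_mul_eq_asc_mul (j := 1) (l := k) (z := z) le_rfl (by omega)
      (by simpa [asc] using e.symm)
    have := congrArg (avoids k) ht
    rw [avoids_halfTwist le_rfl, Nat.add_comm, asc_succ, map_mul, map_mul, Nat.zero_add,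
      avoids_atom_self (by omega : k < m)] at this
    simp at this
  | succ i ih =>
    obtain ⟨k, rfl⟩ := Nat.exists_eq_add_of_le' (by omega : 1 ≤ k)
    -- Passing through the ascending product lowers the index of an atom by one. Used twice, this
    -- moves both factors of the square onto `halfTwist m k`.
    have key : ∀ y z : ArtinMonoid m, atom m (i + 1) * z = asc m 0 (k + 1) * y →
        ∃ t, z = asc m 0 (k + 1) * t ∧ y = atom m i * t := by
      intro y z e
      have e' := e
      obtain ⟨l, hl⟩ := Nat.exists_eq_add_of_le (by omega : i + 2 ≤ k + 1)
      rw [hl, asc_add, asc_succ, asc_succ, Nat.zero_add, Nat.zero_add, Nat.zero_add] at e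
      simp only [mul_assoc] at e
      obtain ⟨t, rfl, e2⟩ := exists_of_atom_mul_eq_asc_mul (m := m) (j := 0) (k := i) (i := i + 1)
        (by omega) (by omega) e
      obtain ⟨r, e, -⟩ := atom_completes_adj (m := m) (i := i) (by omega) e2
      obtain ⟨r, rfl⟩ := exists_of_asc_mul_eq_atom_mul (by omega) (by omega) (mul_left_cancel' e)
      refine ⟨r, mul_left_cancel' (a := atom m (i + 1)) ?_, rfl⟩
      rw [e', ← mul_assoc, ← mul_assoc, atom_succ_mul_asc h hk]
    obtain ⟨t, e1, e2⟩ := key _ _ e.symm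
    obtain ⟨r, -, rfl⟩ := key _ _ e1
    exact ih (k := k) (by omega) (by omega) r e2

end ArtinMonoid
end PosBraid

/-! ### Embedding the Artin monoid in the braid group. -/

namespace PosBraid

theorem of_mul_of_comm {n : ℕ} {i j : Fin (n - 1)} (h : Far i j) :
    (PresentedGroup.of i * PresentedGroup.of j : BraidGroup n) =
      PresentedGroup.of j * PresentedGroup.of i := by
  have key : ∀ i j : Fin (n - 1), (i : ℕ) + 1 < j →
      (PresentedGroup.of i * PresentedGroup.of j : BraidGroup n) =
        PresentedGroup.of j * PresentedGroup.of i := by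
    intro i j h
    have := PresentedGroup.one_of_mem (rels := artinRels n) (.inl ⟨i, j, h, rfl⟩)
    rw [map_mul, map_inv, mul_inv_eq_one, map_mul, map_mul] at this
    exact this
  rcases h with h | h
  · exact key i j h
  · exact (key j i h).symm

theorem of_mul_of_mul_of {n : ℕ} {i j : Fin (n - 1)} (h : Adj i j) :
    (PresentedGroup.of i * PresentedGroup.of j * PresentedGroup.of i : BraidGroup n) =
      PresentedGroup.of j * PresentedGroup.of i * PresentedGroup.of j := by
  have key : ∀ i j : Fin (n - 1), (i : ℕ) + 1 = j →
      (PresentedGroup.of i * PresentedGroup.of j * PresentedGroup.of i : BraidGroup n) =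
        PresentedGroup.of j * PresentedGroup.of i * PresentedGroup.of j := by
    intro i j h
    have := PresentedGroup.one_of_mem (rels := artinRels n) (.inr ⟨i, j, h, rfl⟩)
    rw [map_mul, map_inv, mul_inv_eq_one, map_mul, map_mul, map_mul, map_mul] at this
    exact this
  rcases h with h | h
  · exact key i j h
  · exact (key j i h).symm

namespace ArtinMonoid

/-- The canonical homomorphism from the Artin monoid to the monoid of positive braids. -/
def toBraid (n : ℕ) : ArtinMonoid (n - 1) →* BraidMonoid n :=
  lift σ (fun _ _ h => Subtype.ext (of_mul_of_comm h))
    (fun _ _ h => Subtype.ext (of_mul_of_mul_of h))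

theorem toBraid_mk {n : ℕ} (w : List (Fin (n - 1))) : toBraid n (mk w) = braidOf w :=
  lift_mk _ _ _ w

theorem toBraid_gen {n : ℕ} (i : Fin (n - 1)) : toBraid n (gen i) = σ i :=
  lift_gen _ _ _ i

theorem toBraid_surjective (n : ℕ) : Function.Surjective (toBraid n) := by
  intro β
  obtain ⟨w, rfl⟩ := braidOf_surjective β
  exact ⟨mk w, toBraid_mk w⟩

/-- All elements are inverted. Common left multiples give the Ore condition, and right cancellation
allows the witness 1. -/
noncomputable instance oreSetTop (m : ℕ) : OreLocalization.OreSet (⊤ : Submonoid (ArtinMonoid m)) where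
  ore_right_cancel _ _ _ h := ⟨1, by rw [mul_right_cancel' h]⟩
  oreNum r s := (exists_mul_eq_mul_left r s).choose_spec.choose
  oreDenom r s := ⟨(exists_mul_eq_mul_left r s).choose, trivial⟩
  ore_eq r s := (exists_mul_eq_mul_left r s).choose_spec.choose_spec

/-- The monoid of fractions of the Artin monoid. -/
abbrev Fractions (m : ℕ) : Type := OreLocalization (⊤ : Submonoid (ArtinMonoid m)) (ArtinMonoid m)

/-- The canonical homomorphism to the monoid of fractions. -/
noncomputable def toFractions (m : ℕ) : ArtinMonoid m →* Fractions m := OreLocalization.numeratorHom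

theorem toFractions_injective (m : ℕ) : Function.Injective (toFractions m) := by
  intro x y h
  rw [toFractions, OreLocalization.numeratorHom_apply, OreLocalization.numeratorHom_apply,
    OreLocalization.oreDiv_eq_iff] at h
  obtain ⟨u, v, h1, h2⟩ := h
  have h2 : (u : ArtinMonoid m) = v := by simpa using h2
  have h1 : (u : ArtinMonoid m) * y = v * x := h1
  rw [h2] at h1
  exact (mul_left_cancel' h1).symm

/-- The generators as units of the monoid of fractions. -/
noncomputable def unitGen {m : ℕ} (i : Fin m) : (Fractions m)ˣ :=
  OreLocalization.numeratorUnit (S := (⊤ : Submonoid (ArtinMonoid m))) ⟨gen i, trivial⟩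

theorem val_unitGen {m : ℕ} (i : Fin m) : (unitGen i : Fractions m) = toFractions m (gen i) := rfl

/-- The homomorphism from the braid group to the units of the fractions of the Artin monoid. -/
noncomputable def braidToFractions (n : ℕ) : BraidGroup n →* (Fractions (n - 1))ˣ :=
  PresentedGroup.toGroup (f := unitGen) (by
    rintro r (⟨i, j, h, rfl⟩ | ⟨i, j, h, rfl⟩)
    · rw [map_mul, map_inv, mul_inv_eq_one, map_mul, map_mul, FreeGroup.lift_apply_of,
        FreeGroup.lift_apply_of]
      ext
      rw [Units.val_mul, Units.val_mul, val_unitGen, val_unitGen, ← map_mul, ← map_mul]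
      have := gen_comm (.inl h : Far i j) 1
      rw [mul_one, mul_one] at this
      rw [this]
    · rw [map_mul, map_inv, mul_inv_eq_one, map_mul, map_mul, map_mul, map_mul,
        FreeGroup.lift_apply_of, FreeGroup.lift_apply_of]
      ext
      rw [Units.val_mul, Units.val_mul, Units.val_mul, Units.val_mul, val_unitGen, val_unitGen,
        ← map_mul, ← map_mul, ← map_mul, ← map_mul]
      have := gen_braid (.inl h : Adj i j) 1
      rw [mul_one, mul_one] at this
      rw [mul_assoc, this, mul_assoc])

theorem braidToFractions_toBraid {n : ℕ} (x : ArtinMonoid (n - 1)) :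
    (braidToFractions n (toBraid n x) : Fractions (n - 1)) = toFractions (n - 1) x := by
  obtain ⟨w, rfl⟩ := mk_surjective x
  induction w with
  | nil => simp [mk_nil]
  | cons i w ih =>
    rw [mk_cons, map_mul, Submonoid.coe_mul, map_mul, Units.val_mul, ih, map_mul, toBraid_gen,
      ← val_unitGen, braidToFractions, σ, PresentedGroup.toGroup.of]

/-- The generators become units among the fractions, so the braid group maps there; composed with
`toBraid n` this is the injective map `toFractions`. -/
theorem toBraid_injective (n : ℕ) : Function.Injective (toBraid n) := by
  intro x y h
  apply toFractions_injective
  rw [← braidToFractions_toBraid, h, braidToFractions_toBraid]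

end ArtinMonoid
end PosBraid

namespace PosBraid

/-! ### Positive braids: length, lcms and the Garside element. -/

variable {n : ℕ}

theorem braidOf_nil : (braidOf [] : BraidMonoid n) = 1 := rfl

theorem braidOf_cons (i : Fin (n - 1)) (w : List (Fin (n - 1))) :
    (braidOf (i :: w) : BraidMonoid n) = σ i * braidOf w := by
  simp [braidOf]

theorem braidOf_append (u v : List (Fin (n - 1))) :
    (braidOf (u ++ v) : BraidMonoid n) = braidOf u * braidOf v := by
  simp [braidOf]

theorem length_eq_of_braidOf_eq {u v : List (Fin (n - 1))}
    (h : (braidOf u : BraidMonoid n) = braidOf v) : u.length = v.length := by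
  have h1 := lengthHom_braidOf u
  rw [h, lengthHom_braidOf v] at h1
  exact_mod_cast (Multiplicative.ofAdd.injective h1).symm

theorem lexRep_isLeast (β : BraidMonoid n) : IsLeast {u | braidOf u = β} (lexRep β) :=
  (exists_lexRep β).choose_spec

theorem braidOf_lexRep (β : BraidMonoid n) : braidOf (lexRep β) = β := (lexRep_isLeast β).1

/-- The length of a positive braid. -/
noncomputable def blen (β : BraidMonoid n) : ℕ := (lexRep β).length

theorem blen_braidOf (w : List (Fin (n - 1))) : blen (braidOf w : BraidMonoid n) = w.length :=
  length_eq_of_braidOf_eq (braidOf_lexRep _)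

theorem blen_mul (x y : BraidMonoid n) : blen (x * y) = blen x + blen y := by
  rw [← braidOf_lexRep x, ← braidOf_lexRep y, ← braidOf_append]
  simp only [blen_braidOf, List.length_append]

theorem blen_one : blen (1 : BraidMonoid n) = 0 := blen_braidOf []

theorem blen_sigma (i : Fin (n - 1)) : blen (σ i : BraidMonoid n) = 1 := by
  simpa [braidOf] using blen_braidOf (n := n) [i]

theorem eq_one_of_blen_eq_zero {x : BraidMonoid n} (h : blen x = 0) : x = 1 := by
  rw [← braidOf_lexRep x, List.length_eq_zero_iff.1 h, braidOf_nil]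

theorem eq_one_or_exists_sigma_mul (x : BraidMonoid n) : x = 1 ∨ ∃ i y, x = σ i * y := by
  obtain ⟨w, rfl⟩ := braidOf_surjective x
  cases w with
  | nil => exact .inl rfl
  | cons i w => exact .inr ⟨i, _, braidOf_cons i w⟩

theorem prefix_antisymm {x y : BraidMonoid n} (h : x ∣ y) (h' : y ∣ x) : x = y := by
  obtain ⟨a, rfl⟩ := h
  obtain ⟨b, hb⟩ := h'
  have := congrArg blen hb
  rw [blen_mul, blen_mul] at this
  rw [eq_one_of_blen_eq_zero (by omega : blen a = 0), mul_one]

theorem dvd_of_mul_dvd_mul {a x y : BraidMonoid n} (h : a * x ∣ a * y) : x ∣ y := by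
  obtain ⟨z, hz⟩ := h
  exact ⟨z, mul_left_cancel (hz.trans (mul_assoc _ _ _))⟩

theorem sigma_comm {i j : Fin (n - 1)} (h : Far i j) :
    (σ i * σ j : BraidMonoid n) = σ j * σ i := Subtype.ext (of_mul_of_comm h)

theorem sigma_braid {i j : Fin (n - 1)} (h : Adj i j) :
    (σ i * (σ j * σ i) : BraidMonoid n) = σ j * (σ i * σ j) := by
  rw [← mul_assoc, ← mul_assoc]
  exact Subtype.ext (of_mul_of_mul_of h)

theorem sigma_completes {i j : Fin (n - 1)} {x y : BraidMonoid n} (h : σ i * x = σ j * y) :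
    (i = j ∧ x = y) ∨ (Far i j ∧ ∃ z, x = σ j * z ∧ y = σ i * z) ∨
      (Adj i j ∧ ∃ z, x = σ j * (σ i * z) ∧ y = σ i * (σ j * z)) := by
  obtain ⟨x, rfl⟩ := ArtinMonoid.toBraid_surjective n x
  obtain ⟨y, rfl⟩ := ArtinMonoid.toBraid_surjective n y
  simp only [← ArtinMonoid.toBraid_gen, ← map_mul] at h ⊢
  rcases ArtinMonoid.completes (ArtinMonoid.toBraid_injective n h) with
    ⟨h1, rfl⟩ | ⟨h1, z, rfl, rfl⟩ | ⟨h1, z, rfl, rfl⟩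
  · exact .inl ⟨h1, rfl⟩
  · exact .inr (.inl ⟨h1, ArtinMonoid.toBraid n z, by simp, by simp⟩)
  · exact .inr (.inr ⟨h1, ArtinMonoid.toBraid n z, by simp, by simp⟩)

theorem sigma_injective : Function.Injective (σ : Fin (n - 1) → BraidMonoid n) := by
  intro i j h
  have h : (σ i * 1 : BraidMonoid n) = σ j * 1 := by rw [h]
  rcases sigma_completes h with ⟨h, -⟩ | ⟨-, z, h, -⟩ | ⟨-, z, h, -⟩
  · exact h
  · have := congrArg blen h
    rw [blen_one, blen_mul, blen_sigma] at this
    omega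
  · have := congrArg blen h
    rw [blen_one, blen_mul, blen_sigma] at this
    omega

theorem exists_isLcm_sigma (i j : Fin (n - 1)) : ∃ m : BraidMonoid n, IsLcm (σ i) (σ j) m := by
  rcases eq_or_far_or_adj i j with rfl | h | h
  · exact ⟨σ i, dvd_rfl, dvd_rfl, fun _ h _ => h⟩
  · refine ⟨σ i * σ j, ⟨_, rfl⟩, ⟨_, sigma_comm h⟩, ?_⟩
    rintro m ⟨x, rfl⟩ ⟨y, e⟩
    rcases sigma_completes e with ⟨rfl, -⟩ | ⟨-, z, rfl, -⟩ | ⟨h', -⟩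
    · exact absurd h (by unfold Far; omega)
    · exact ⟨z, (mul_assoc _ _ _).symm⟩
    · exact absurd h (by unfold Far Adj at *; omega)
  · refine ⟨σ i * (σ j * σ i), ⟨_, rfl⟩, ⟨_, sigma_braid h⟩, ?_⟩
    rintro m ⟨x, rfl⟩ ⟨y, e⟩
    rcases sigma_completes e with ⟨rfl, -⟩ | ⟨h', -⟩ | ⟨-, z, rfl, -⟩
    · exact absurd h (by unfold Adj; omega)
    · exact absurd h (by unfold Far Adj at *; omega)
    · exact ⟨z, by simp only [mul_assoc]⟩

/-- Induction on the length of a common multiple, which reduces all lcms to those of two generators.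
-/
theorem exists_isLcm_of_dvd (l : ℕ) : ∀ x a b : BraidMonoid n, blen x ≤ l → a ∣ x → b ∣ x →
    ∃ m, IsLcm a b m := by
  induction l with
  | zero =>
    rintro _ a b hl ⟨a', rfl⟩ -
    rw [blen_mul] at hl
    rw [eq_one_of_blen_eq_zero (by omega : blen a = 0)]
    exact ⟨b, one_dvd _, dvd_rfl, fun _ _ h => h⟩
  | succ l ih =>
    intro x a b hl ha hb
    rcases eq_one_or_exists_sigma_mul a with rfl | ⟨i, a, rfl⟩
    · exact ⟨b, one_dvd _, dvd_rfl, fun _ _ h => h⟩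
    rcases eq_one_or_exists_sigma_mul b with rfl | ⟨j, b, rfl⟩
    · exact ⟨_, dvd_rfl, one_dvd _, fun _ h _ => h⟩
    obtain ⟨D, ⟨p, hp⟩, ⟨q, hq⟩, hD⟩ := exists_isLcm_sigma (n := n) i j
    obtain ⟨e, he⟩ := hD x (dvd_of_mul_right_dvd ha) (dvd_of_mul_right_dvd hb)
    have hlen : ∀ (k : Fin (n - 1)) (r : BraidMonoid n), D = σ k * r → blen (r * e) ≤ l := by
      intro k r hr
      rw [he, hr, mul_assoc, blen_mul, blen_sigma] at hl
      omega
    -- Every common multiple has the form `D * z`. Here `u` is the residual of `c` by `r`, so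
    -- divisibility by `σ k * c` becomes the condition `u ∣ z`; the lcm sought is then `D` times the
    -- lcm of the two residuals.
    have key : ∀ (k : Fin (n - 1)) (c r : BraidMonoid n), D = σ k * r → σ k * c ∣ x →
        ∃ u, u ∣ e ∧ ∀ z, σ k * c ∣ D * z ↔ u ∣ z := by
      intro k c r hr hc
      rw [he, hr, mul_assoc] at hc
      obtain ⟨_, h1, ⟨u, rfl⟩, h3⟩ := ih (r * e) c r (hlen k r hr) (dvd_of_mul_dvd_mul hc)
        (dvd_mul_right _ _)
      refine ⟨u, dvd_of_mul_dvd_mul (h3 _ (dvd_of_mul_dvd_mul hc) (dvd_mul_right _ _)), ?_⟩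
      intro z
      rw [hr, mul_assoc]
      constructor
      · intro h
        exact dvd_of_mul_dvd_mul (h3 _ (dvd_of_mul_dvd_mul h) (dvd_mul_right _ _))
      · intro h
        exact mul_dvd_mul_left _ (h1.trans (mul_dvd_mul_left _ h))
    obtain ⟨u, hu, hu'⟩ := key i a p hp ha
    obtain ⟨v, hv, hv'⟩ := key j b q hq hb
    have hel : blen e ≤ l := by
      have := hlen i p hp
      rw [blen_mul] at this
      omega
    obtain ⟨t, h1, h2, h3⟩ := ih e u v hel hu hv
    refine ⟨D * t, (hu' t).2 h1, (hv' t).2 h2, ?_⟩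
    intro y hay hby
    obtain ⟨z, rfl⟩ := hD y (dvd_of_mul_right_dvd hay) (dvd_of_mul_right_dvd hby)
    exact mul_dvd_mul_left _ (h3 z ((hu' z).1 hay) ((hv' z).1 hby))

theorem exists_isLcm (a b : BraidMonoid n) : ∃ m, IsLcm a b m := by
  obtain ⟨a, rfl⟩ := ArtinMonoid.toBraid_surjective n a
  obtain ⟨b, rfl⟩ := ArtinMonoid.toBraid_surjective n b
  obtain ⟨c, d, h⟩ := ArtinMonoid.exists_mul_eq_mul a b
  refine exists_isLcm_of_dvd _ (ArtinMonoid.toBraid n (a * c)) _ _ le_rfl ?_ ?_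
  · rw [map_mul]; exact dvd_mul_right _ _
  · rw [h, map_mul]; exact dvd_mul_right _ _

/-- The Garside element. -/
noncomputable def garside (n : ℕ) : BraidMonoid n :=
  ArtinMonoid.toBraid n (ArtinMonoid.halfTwist (n - 1) (n - 1))

theorem sigma_dvd_garside (i : Fin (n - 1)) : σ i ∣ garside n := by
  rw [← ArtinMonoid.toBraid_gen]
  exact map_dvd _ (ArtinMonoid.gen_dvd_halfTwist i)

theorem dvd_garside_of_mul_dvd {x y : BraidMonoid n} (h : x * y ∣ garside n) :
    y ∣ garside n := by
  obtain ⟨z, hz⟩ := h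
  obtain ⟨x, rfl⟩ := ArtinMonoid.toBraid_surjective n x
  obtain ⟨y, rfl⟩ := ArtinMonoid.toBraid_surjective n y
  obtain ⟨z, rfl⟩ := ArtinMonoid.toBraid_surjective n z
  rw [garside, mul_assoc, ← map_mul, ← map_mul] at hz
  refine dvd_of_mul_right_dvd (b := ArtinMonoid.toBraid n z) ?_
  rw [← map_mul]
  exact map_dvd _ (ArtinMonoid.dvd_halfTwist_of_mul_eq (ArtinMonoid.toBraid_injective n hz).symm)

theorem not_sigma_sq_dvd_garside (i : Fin (n - 1)) : ¬ (σ i * σ i ∣ garside n) := by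
  rintro ⟨z, hz⟩
  obtain ⟨z, rfl⟩ := ArtinMonoid.toBraid_surjective n z
  rw [garside, mul_assoc, ← ArtinMonoid.toBraid_gen, ← map_mul, ← map_mul,
    ← ArtinMonoid.atom_val] at hz
  exact ArtinMonoid.not_atom_sq_dvd_halfTwist i.2 le_rfl z (ArtinMonoid.toBraid_injective n hz)

theorem finite_setOf_dvd (g : BraidMonoid n) : {x | x ∣ g}.Finite := by
  refine ((List.finite_length_le (Fin (n - 1)) (blen g)).image braidOf).subset ?_
  rintro x ⟨y, rfl⟩
  refine ⟨lexRep x, ?_, braidOf_lexRep x⟩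
  change blen x ≤ _
  rw [blen_mul]
  exact Nat.le_add_right _ _

end PosBraid

/-! ### Lexicographic representatives, forbidden prefixes and the automaton. -/

namespace PosBraid

variable {n : ℕ}

theorem append_lt_append_of_length_eq {α : Type*} [LinearOrder α] {u v : List α} (h : u < v)
    (hl : u.length = v.length) (w : List α) : u ++ w < v ++ w := by
  induction u generalizing v with
  | nil =>
    rw [List.eq_nil_of_length_eq_zero hl.symm] at h
    exact absurd h (lt_irrefl _)
  | cons a u ih =>
    cases v with
    | nil => simp at hl
    | cons b v =>
      rw [List.cons_append, List.cons_append, List.cons_lt_cons_iff]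
      rcases List.cons_lt_cons_iff.1 h with h | ⟨h, h'⟩
      · exact .inl h
      · exact .inr ⟨h, ih h' (by simpa using hl)⟩

theorem lexRep_le {u : List (Fin (n - 1))} {β : BraidMonoid n} (h : braidOf u = β) :
    lexRep β ≤ u := (lexRep_isLeast β).2 h

theorem lexRep_braidOf {w : List (Fin (n - 1))} (h : w ∈ lexLanguage n) :
    lexRep (braidOf w : BraidMonoid n) = w := by
  obtain ⟨β, rfl⟩ := h
  rw [braidOf_lexRep]

theorem lexRep_mem (β : BraidMonoid n) : lexRep β ∈ lexLanguage n := ⟨β, rfl⟩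

theorem mem_lexLanguage_iff {w : List (Fin (n - 1))} :
    w ∈ lexLanguage n ↔ ∀ u, (braidOf u : BraidMonoid n) = braidOf w → w ≤ u := by
  constructor
  · intro h u hu
    rw [← lexRep_braidOf h]
    exact lexRep_le hu
  · intro h
    exact ⟨braidOf w, le_antisymm (lexRep_le rfl) (h _ (braidOf_lexRep _))⟩

theorem mem_lexLanguage_of_append_left {u v : List (Fin (n - 1))} (h : u ++ v ∈ lexLanguage n) :
    u ∈ lexLanguage n := by
  rw [mem_lexLanguage_iff] at h ⊢
  intro w hw
  by_contra hlt
  refine absurd (h (w ++ v) (by rw [braidOf_append, braidOf_append, hw])) (not_le.2 ?_)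
  exact append_lt_append_of_length_eq (not_le.1 hlt) (length_eq_of_braidOf_eq hw) v

theorem mem_lexLanguage_of_append_right {u v : List (Fin (n - 1))}
    (h : u ++ v ∈ lexLanguage n) : v ∈ lexLanguage n := by
  rw [mem_lexLanguage_iff] at h ⊢
  intro w hw
  by_contra hlt
  refine absurd (h (u ++ w) (by rw [braidOf_append, braidOf_append, hw])) (not_le.2 ?_)
  exact List.append_left_lt (not_le.1 hlt)

theorem nil_mem_lexLanguage : [] ∈ lexLanguage n := ⟨1, lexRep_one⟩

/-- A smaller representative beginning with the same letter `i` would, after cancelling `σ i`,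
undercut `lexRep α`; hence its first letter must be smaller. -/
theorem cons_lexRep_notMem_iff {i : Fin (n - 1)} {α : BraidMonoid n} :
    i :: lexRep α ∉ lexLanguage n ↔ ∃ k < i, σ k ∣ σ i * α := by
  have e : (braidOf (i :: lexRep α) : BraidMonoid n) = σ i * α := by
    rw [braidOf_cons, braidOf_lexRep]
  rw [mem_lexLanguage_iff, e]
  push Not
  constructor
  · rintro ⟨u, hu, hlt⟩
    cases u with
    | nil => simpa using length_eq_of_braidOf_eq (hu.trans e.symm)
    | cons k u =>
      rcases List.cons_lt_cons_iff.1 hlt with h | ⟨rfl, h⟩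
      · exact ⟨k, h, _, by rw [← hu, braidOf_cons]⟩
      · rw [braidOf_cons] at hu
        exact absurd (lexRep_le (mul_left_cancel hu)) (not_le.2 h)
  · rintro ⟨k, hk, y, hy⟩
    exact ⟨k :: lexRep y, by rw [hy, braidOf_cons, braidOf_lexRep],
      List.cons_lt_cons_iff.2 (.inl hk)⟩

theorem mem_forbidden_append_singleton {w : List (Fin (n - 1))} {i : Fin (n - 1)}
    {α : BraidMonoid n} :
    α ∈ forbidden (w ++ [i]) ↔ σ i * α ∈ forbidden w ∨ ∃ k < i, σ k ∣ σ i * α := by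
  rw [← cons_lexRep_notMem_iff]
  change w ++ [i] ++ lexRep α ∉ _ ↔ w ++ lexRep (σ i * α) ∉ _ ∨ _
  rw [List.append_assoc, List.singleton_append]
  by_cases h : i :: lexRep α ∈ lexLanguage n
  · have := lexRep_braidOf h
    rw [braidOf_cons, braidOf_lexRep] at this
    simp [h, this]
  -- Suffixes of words of the language stay in the language, so a bad suffix spoils the whole word.
  · simp only [h, not_false_eq_true, or_true, iff_true]
    exact fun h' => h (mem_lexLanguage_of_append_right h')

theorem notMem_forbidden_nil (α : BraidMonoid n) : α ∉ forbidden [] :=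
  not_not.2 (lexRep_mem α)

theorem forbidden_of_dvd {w : List (Fin (n - 1))} {α β : BraidMonoid n} (h : α ∣ β)
    (hα : α ∈ forbidden w) : β ∈ forbidden w := by
  induction w using List.reverseRecOn generalizing α β with
  | nil => exact absurd hα (notMem_forbidden_nil _)
  | append_singleton w i ih =>
    rw [mem_forbidden_append_singleton] at hα ⊢
    have hd := mul_dvd_mul_left (σ i) h
    exact hα.imp (ih hd) fun ⟨k, hk, hk'⟩ => ⟨k, hk, hk'.trans hd⟩

theorem exists_minPrefixes_dvd {X : Set (BraidMonoid n)} {x : BraidMonoid n} (hx : x ∈ X) :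
    ∃ y ∈ minPrefixes X, y ∣ x := by
  induction hl : blen x using Nat.strong_induction_on generalizing x with
  | _ l ih =>
    by_cases h : ∀ y ∈ X, y ∣ x → y = x
    · exact ⟨x, ⟨hx, h⟩, dvd_rfl⟩
    · push Not at h
      obtain ⟨y, hy, ⟨z, rfl⟩, hne⟩ := h
      rw [blen_mul] at hl
      have hz : blen z ≠ 0 := fun h => hne (by rw [eq_one_of_blen_eq_zero h, mul_one])
      obtain ⟨t, ht, ht'⟩ := ih (blen y) (by omega) hy rfl
      exact ⟨t, ht, dvd_mul_of_dvd_left ht' z⟩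

/-- The hypotheses say that `X` and `Y` have the same right multiples; minimal elements depend only
on these, by antisymmetry of the prefix order. -/
theorem minPrefixes_subset_of_dvd {X Y : Set (BraidMonoid n)} (h : ∀ x ∈ X, ∃ y ∈ Y, y ∣ x)
    (h' : ∀ y ∈ Y, ∃ x ∈ X, x ∣ y) : minPrefixes X ⊆ minPrefixes Y := by
  rintro x ⟨hx, hmin⟩
  have key : ∀ y ∈ Y, y ∣ x → y = x := by
    intro y hy hyx
    obtain ⟨z, hz, hzy⟩ := h' y hy
    obtain rfl := hmin z hz (hzy.trans hyx)
    exact prefix_antisymm hyx hzy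
  obtain ⟨y, hy, hyx⟩ := h x hx
  exact ⟨key y hy hyx ▸ hy, key⟩

theorem one_notMem_forbidden {w : List (Fin (n - 1))} (h : w ∈ lexLanguage n) :
    (1 : BraidMonoid n) ∉ forbidden w := by
  change ¬ (_ ∉ _)
  rw [lexRep_one, List.append_nil]
  exact not_not.2 h

theorem lexRep_sigma (i : Fin (n - 1)) : lexRep (σ i : BraidMonoid n) = [i] := by
  obtain ⟨j, hj⟩ := List.length_eq_one_iff.1 (blen_sigma i)
  have h := braidOf_lexRep (σ i)
  rw [hj, braidOf_cons, braidOf_nil, mul_one] at h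
  rw [hj, sigma_injective h]

theorem sigma_mem_minForbidden_iff {w : List (Fin (n - 1))} (h : w ∈ lexLanguage n)
    {i : Fin (n - 1)} : σ i ∈ minForbidden w ↔ w ++ [i] ∉ lexLanguage n := by
  rw [← lexRep_sigma]
  refine ⟨fun h => h.1, fun hi => ⟨hi, ?_⟩⟩
  rintro y hy ⟨z, hz⟩
  have hl := congrArg blen hz
  rw [blen_sigma, blen_mul] at hl
  have hy' : blen y ≠ 0 := fun h0 => one_notMem_forbidden h (eq_one_of_blen_eq_zero h0 ▸ hy)
  rw [hz, eq_one_of_blen_eq_zero (by omega : blen z = 0), mul_one]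

theorem mem_forbidden_iff {w : List (Fin (n - 1))} {x : BraidMonoid n} :
    x ∈ forbidden w ↔ ∃ y ∈ minForbidden w, y ∣ x :=
  ⟨exists_minPrefixes_dvd, fun ⟨_, hy, hyx⟩ => forbidden_of_dvd hyx hy.1⟩

theorem trans_minForbidden {w : List (Fin (n - 1))} {i : Fin (n - 1)}
    (h : σ i ∉ minForbidden w) : trans (minForbidden w) i = minForbidden (w ++ [i]) := by
  rw [trans, if_neg h]
  have h1 : ∀ x ∈ ({x | ∃ k : Fin (n - 1), (k : ℕ) + 1 < i ∧ x = σ k} ∪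
      {x | ∃ k : Fin (n - 1), (k : ℕ) + 1 = i ∧ x = σ k * σ i} ∪
      {c | ∃ β ∈ minForbidden w, IsResidual (σ i) β c} : Set (BraidMonoid n)),
      ∃ y ∈ forbidden (w ++ [i]), y ∣ x := by
    intro x hx
    refine ⟨x, mem_forbidden_append_singleton.2 ?_, dvd_rfl⟩
    rcases hx with (⟨k, hk, rfl⟩ | ⟨k, hk, rfl⟩) | ⟨β, hβ, hx⟩
    · exact .inr ⟨k, Fin.lt_def.2 (by omega), _, sigma_comm (.inr hk)⟩
    · exact .inr ⟨k, Fin.lt_def.2 (by omega), _, sigma_braid (.inr hk)⟩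
    · exact .inl (forbidden_of_dvd hx.2.1 hβ.1)
  have h2 : ∀ x ∈ forbidden (w ++ [i]),
      ∃ y ∈ ({x | ∃ k : Fin (n - 1), (k : ℕ) + 1 < i ∧ x = σ k} ∪
      {x | ∃ k : Fin (n - 1), (k : ℕ) + 1 = i ∧ x = σ k * σ i} ∪
      {c | ∃ β ∈ minForbidden w, IsResidual (σ i) β c} : Set (BraidMonoid n)), y ∣ x := by
    intro x hx
    rcases mem_forbidden_append_singleton.1 hx with hx | ⟨k, hk, y, hy⟩
    · obtain ⟨β, hβ, hβx⟩ := mem_forbidden_iff.1 hx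
      obtain ⟨m, hm⟩ := exists_isLcm (σ i) β
      obtain ⟨c, rfl⟩ := hm.1
      exact ⟨c, .inr ⟨β, hβ, hm⟩, dvd_of_mul_dvd_mul (hm.2.2 _ (dvd_mul_right _ _) hβx)⟩
    -- By Garside's lemma `σ k ∣ σ i * x` forces the residual of `σ k` by `σ i` to be a prefix of
    -- `x`: it is `σ k` for distant indices. For adjacent ones it is `σ k * σ i`.
    · have hk' := Fin.lt_def.1 hk
      rcases sigma_completes hy with ⟨rfl, -⟩ | ⟨h', z, rfl, -⟩ | ⟨h', z, rfl, -⟩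
      · exact absurd hk (lt_irrefl _)
      · exact ⟨σ k, .inl (.inl ⟨k, by unfold Far at h'; omega, rfl⟩), dvd_mul_right _ _⟩
      · exact ⟨σ k * σ i, .inl (.inr ⟨k, by unfold Adj at h'; omega, rfl⟩), z,
          (mul_assoc _ _ _).symm⟩
  exact (minPrefixes_subset_of_dvd h1 h2).antisymm (minPrefixes_subset_of_dvd h2 h1)

theorem minForbidden_append_singleton_subset {w : List (Fin (n - 1))} {i : Fin (n - 1)}
    (h : w ++ [i] ∈ lexLanguage n) {x : BraidMonoid n} (hx : x ∈ minForbidden (w ++ [i])) :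
    (∃ k : Fin (n - 1), (k : ℕ) + 1 < i ∧ x = σ k) ∨
      (∃ k : Fin (n - 1), (k : ℕ) + 1 = i ∧ x = σ k * σ i) ∨
      ∃ β ∈ minForbidden w, IsResidual (σ i) β x := by
  have hi : σ i ∉ minForbidden w := fun h' =>
    (sigma_mem_minForbidden_iff (mem_lexLanguage_of_append_left h)).1 h' h
  rw [← trans_minForbidden hi, trans, if_neg hi] at hx
  exact or_assoc.1 hx.1

/-- Divisors of $\Delta$ are closed under lcms and under suffixes, hence under residuals; the
products `σ k * σ i` are suffixes of the lcm of two generators. -/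
theorem dvd_garside_of_mem_minForbidden {w : List (Fin (n - 1))} (h : w ∈ lexLanguage n)
    {x : BraidMonoid n} (hx : x ∈ minForbidden w) : x ∣ garside n := by
  induction w using List.reverseRecOn generalizing x with
  | nil => exact absurd hx.1 (notMem_forbidden_nil _)
  | append_singleton w i ih =>
    rcases minForbidden_append_singleton_subset h hx with ⟨k, -, rfl⟩ | ⟨k, hk, rfl⟩ | ⟨β, hβ, hm⟩
    · exact sigma_dvd_garside k
    · obtain ⟨a, ha⟩ := sigma_dvd_garside k
      obtain ⟨b, hb⟩ := sigma_dvd_garside i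
      rcases sigma_completes (ha.symm.trans hb) with ⟨rfl, -⟩ | ⟨h', -⟩ | ⟨-, z, rfl, -⟩
      · omega
      · exact absurd h' (by unfold Far; omega)
      · exact dvd_garside_of_mul_dvd (x := σ i) ⟨z, by
          rw [ha, ← sigma_braid (.inl hk)]
          simp only [mul_assoc]⟩
    · exact dvd_garside_of_mul_dvd
        (hm.2.2 _ (sigma_dvd_garside i) (ih (mem_lexLanguage_of_append_left h) hβ))

theorem minForbidden_ne_failState (hn : 2 ≤ n) {w : List (Fin (n - 1))}
    (h : w ∈ lexLanguage n) : minForbidden w ≠ failState n := by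
  intro e
  induction w using List.reverseRecOn with
  | nil =>
    have : (σ ⟨0, by omega⟩ : BraidMonoid n) ∈ failState n := ⟨_, rfl⟩
    rw [← e] at this
    exact notMem_forbidden_nil _ this.1
  | append_singleton w i _ =>
    have hi : σ i ∈ minForbidden (w ++ [i]) := e ▸ ⟨i, rfl⟩
    rcases minForbidden_append_singleton_subset h hi with ⟨k, hk, hki⟩ | ⟨k, -, hki⟩ | ⟨β, hβ, hm⟩
    · rw [sigma_injective hki] at hk
      omega
    · have := congrArg blen hki
      rw [blen_mul, blen_sigma, blen_sigma] at this
      omega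
    -- Here $\sigma_i^2$ would be the lcm of $\sigma_i$ and $\beta$, both of which divide $\Delta$.
    · exact not_sigma_sq_dvd_garside i (hm.2.2 _ (sigma_dvd_garside i)
        (dvd_garside_of_mem_minForbidden (mem_lexLanguage_of_append_left h) hβ))

theorem trans_failState (i : Fin (n - 1)) : trans (failState n) i = failState n :=
  if_pos ⟨i, rfl⟩

theorem trans_minForbidden_of_mem {w : List (Fin (n - 1))} {i : Fin (n - 1)}
    (h : w ++ [i] ∈ lexLanguage n) : trans (minForbidden w) i = minForbidden (w ++ [i]) :=
  trans_minForbidden fun h' =>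
    (sigma_mem_minForbidden_iff (mem_lexLanguage_of_append_left h)).1 h' h

theorem trans_minForbidden_of_notMem {w : List (Fin (n - 1))} {i : Fin (n - 1)}
    (hw : w ∈ lexLanguage n) (h : w ++ [i] ∉ lexLanguage n) :
    trans (minForbidden w) i = failState n :=
  if_pos ((sigma_mem_minForbidden_iff hw).2 h)

theorem trans_mem_states (S : Set (BraidMonoid n)) (hS : S ∈ states n) (i : Fin (n - 1)) :
    trans S i ∈ states n := by
  rcases hS with ⟨w, hw, rfl⟩ | rfl
  · by_cases h : w ++ [i] ∈ lexLanguage n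
    · exact .inl ⟨_, h, trans_minForbidden_of_mem h⟩
    · exact .inr (trans_minForbidden_of_notMem hw h)
  · exact .inr (trans_failState i)

theorem states_finite (n : ℕ) : (states n).Finite := by
  refine (finite_setOf_dvd (garside n)).finite_subsets.subset ?_
  rintro S (⟨w, hw, rfl⟩ | rfl)
  · exact fun x hx => dvd_garside_of_mem_minForbidden hw hx
  · rintro _ ⟨i, rfl⟩
    exact sigma_dvd_garside i

open Classical in
theorem Gamma_eval (h) (w : List (Fin (n - 1))) :
    ((Gamma n h).eval w).1 = if w ∈ lexLanguage n then minForbidden w else failState n := by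
  induction w using List.reverseRecOn with
  | nil => rw [if_pos nil_mem_lexLanguage, minForbidden_nil]; rfl
  | append_singleton w i ih =>
    rw [DFA.eval_append_singleton]
    change trans ((Gamma n h).eval w).1 i = _
    rw [ih]
    by_cases hw : w ∈ lexLanguage n
    · rw [if_pos hw]
      split_ifs with hi
      · exact trans_minForbidden_of_mem hi
      · exact trans_minForbidden_of_notMem hw hi
    · rw [if_neg hw, if_neg fun h' => hw (mem_lexLanguage_of_append_left h'), trans_failState]

theorem Gamma_accepts (hn : 2 ≤ n) (h) : (Gamma n h).accepts = lexLanguage n := by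
  ext w
  rw [DFA.mem_accepts]
  change ((Gamma n h).eval w).1 ≠ failState n ↔ _
  rw [Gamma_eval]
  split_ifs with hw
  · exact iff_of_true (minForbidden_ne_failState hn hw) hw
  · exact iff_of_false (not_not.2 rfl) hw

/-- Makes the fail state reachable. With a single generator every word is its own only
representative. -/
theorem exists_notMem_lexLanguage (hn : 3 ≤ n) : ∃ w, w ∉ lexLanguage n := by
  let a : Fin (n - 1) := ⟨0, by omega⟩
  let b : Fin (n - 1) := ⟨1, by omega⟩
  refine ⟨[b, a, b], fun h => ?_⟩
  have hlt : [a, b, a] < [b, a, b] :=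
    List.cons_lt_cons_iff.2 (.inl (Fin.lt_def.2 Nat.zero_lt_one))
  refine absurd (mem_lexLanguage_iff.1 h [a, b, a] ?_) (not_le.2 hlt)
  simp only [braidOf_cons, braidOf_nil, mul_one]
  exact sigma_braid (.inl rfl)

theorem minForbidden_eq_of_quotient {u v : List (Fin (n - 1))}
    (h : ∀ x, u ++ x ∈ lexLanguage n ↔ v ++ x ∈ lexLanguage n) :
    minForbidden u = minForbidden v := by
  have : (forbidden u : Set (BraidMonoid n)) = forbidden v :=
    Set.ext fun α => not_congr (h (lexRep α))
  rw [minForbidden, this, minForbidden]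

theorem card_states_le (hn : 3 ≤ n) {Q : Type*} [Finite Q] (D : DFA (Fin (n - 1)) Q)
    (hD : D.accepts = lexLanguage n) : Nat.card (states n) ≤ Nat.card Q := by
  obtain ⟨v, hv⟩ := exists_notMem_lexLanguage hn
  -- Each state gets a word leading to it, with `v` serving the fail state; a competing automaton
  -- must send the words of different states to different states.
  have hw : ∀ S : states n, ∃ w : List (Fin (n - 1)),
      (w ∈ lexLanguage n → S.1 = minForbidden w) ∧ (w ∉ lexLanguage n → S.1 = failState n) := by
    rintro ⟨S, ⟨w, hw, rfl⟩ | rfl⟩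
    · exact ⟨w, fun _ => rfl, fun h => absurd hw h⟩
    · exact ⟨v, fun h => absurd h hv, fun _ => rfl⟩
  choose f hf hf' using hw
  refine Nat.card_le_card_of_injective (fun S => D.eval (f S)) fun S T hST => ?_
  have hq : ∀ x, f S ++ x ∈ lexLanguage n ↔ f T ++ x ∈ lexLanguage n := by
    intro x
    have hST : D.eval (f S) = D.eval (f T) := hST
    rw [← hD, DFA.mem_accepts, DFA.mem_accepts, DFA.eval, DFA.evalFrom_of_append,
      DFA.evalFrom_of_append]
    change D.evalFrom (D.eval (f S)) x ∈ _ ↔ D.evalFrom (D.eval (f T)) x ∈ _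
    rw [hST]
  have h0 := hq []
  rw [List.append_nil, List.append_nil] at h0
  apply Subtype.ext
  by_cases hS : f S ∈ lexLanguage n
  · rw [hf S hS, hf T (h0.1 hS), minForbidden_eq_of_quotient hq]
  · rw [hf' S hS, hf' T (fun h => hS (h0.2 h))]

end PosBraid

theorem proposition5p2 (n : ℕ) (hn : 2 ≤ n) :
    (∃ h : ∀ S ∈ PosBraid.states n, ∀ i : Fin (n - 1), PosBraid.trans S i ∈ PosBraid.states n,
      (PosBraid.states n).Finite ∧
      (PosBraid.Gamma n h).accepts = PosBraid.lexLanguage n) ∧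
    (3 ≤ n → ∀ (Q : Type*) [Finite Q] (D : DFA (Fin (n - 1)) Q),
      D.accepts = PosBraid.lexLanguage n → Nat.card (PosBraid.states n) ≤ Nat.card Q) :=
  ⟨⟨PosBraid.trans_mem_states, PosBraid.states_finite n, PosBraid.Gamma_accepts hn _⟩,
    fun h _ _ D hD => PosBraid.card_states_le h D hD⟩
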